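/- Let $G$ be a finite connected multigraph, cellularly embedded in a closed (orientable or nonorientable) surface $S$, and let $\alpha$ be an ordinary voltage assignment on the darts of $G$ with values in a finite group $A$, so that $\alpha(d^{-1})=\alpha(d)^{-1}$. Let $G^\alpha\to S^\alpha$ be the derived embedding: $G^\alpha$ has vertices $v^a=(v,a)$ and edges $e^a=(e,a)$, the edge $e^a$ running from $t(e)^a$ to $h(e)^{a\alpha(e)}$, and the rotations and the orientation types of the edges are lifted from $G\to S$. For a vertex $v$ let $A(v)\le A$ be the group of net voltages of closed walks of $G$ based at $v$, and let $S_v^a$ be the component of $S^\alpha$ containing $v^a$. Let $M'$ be the subdivided medial graph of $G\to S$. It has a vertex $v_e$ for each edge $e$ of $G$, a vertex for each corner of $G\to S$, and, for each of the two ends of an edge $e$ and each of the two sides of $e$ at that end, an edge joining $v_e$ to the vertex of $M'$ in the corner containing that side of that end of $e$. Choose a preferred direction of every edge $e$ of $G$; the two edges of $M'$ at $v_e$ that come from the tail end of the preferred dart on $e$ get, directed towards $v_e$, the voltage of that dart, and the other two edges at $v_e$ get voltage $1_A$. Let $z\in C_1(G;\mathbb Z_2)$ induce a circle $G\!:\!z$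 such that $S\setminus (G\!:\!z)$ is connected, and assume that its fiber $(G\!:\!z)^\alpha$ is a disjoint union of orientation-preserving circles (circles with an even number of orientation-reversing edges). Let $v$ be a vertex of $G\!:\!z$, let $d_1$ be a dart of $G\!:\!z$ with tail $v$, and let $w'$ be the vertex of $M'$ in either one of the two corners at $v$ next to $d_1$. A walk in $M'$ transversely crosses $G\!:\!z$ if for some edge $e$ of $z$ it arrives at $v_e$ on one side of $e$ and leaves on the other side by its next dart. Let $A'(w',G\!:\!z)\le A$ be the group of net voltages of the closed walks in $M'$ based at $w'$ that do not transversely cross $G\!:\!z$. For $b\in A$ let $z_v^b$ be the 1-chain inducing the component of $(G\!:\!z)^\alpha$ that contains $v^b$. For $a\in A$, the z-regions of $S_v^a$ with respect to $\{z_v^b : b\in aA(v)\}$ are the closures of the connected components of the complement in $S_v^a$ of the circles induced by these 1-chains. Then, for every $a\in A$, the number of these z-regions is exactly $$\frac{|A(v)|}{|A'(w',G\!:\!z)|}.$$ -/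

import Mathlib

namespace VoltageEmbedding

/-! ### Multigraphs, darts, walks -/

/-- A multigraph (loops and parallel edges allowed) with vertex type `V` and edge type `E`; every
edge carries a reference direction, from `src e` to `tgt e`. -/
structure DartGraph (V E : Type*) where
  src : E → V
  tgt : E → V

/-- A dart (directed edge): `(e, true)` is the positive edge on `e`, running from `src e` to
`tgt e`, and `(e, false)` is the negative edge on `e`, running from `tgt e` to `src e`. -/
abbrev Dart (E : Type*) := E × Bool

/-- The opposite dart. -/
def opp {E : Type*} (d : Dart E) : Dart E := (d.1, !d.2)

namespace DartGraph

variable {V E A : Type*}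

def tail (G : DartGraph V E) (d : Dart E) : V := if d.2 then G.src d.1 else G.tgt d.1

def head (G : DartGraph V E) (d : Dart E) : V := if d.2 then G.tgt d.1 else G.src d.1

/-- `G.IsWalk u l v`: the sequence of darts `l` is a walk from `u` to `v`. -/
def IsWalk (G : DartGraph V E) : V → List (Dart E) → V → Prop
  | u, [], v => u = v
  | u, d :: l, v => G.tail d = u ∧ IsWalk G (G.head d) l v

/-- `u` and `v` are joined by a walk using only edges of `z`. -/
def Joined (G : DartGraph V E) (z : Set E) (u v : V) : Prop :=
  ∃ l, G.IsWalk u l v ∧ ∀ d ∈ l, d.1 ∈ z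

def IsConnectedGraph (G : DartGraph V E) : Prop :=
  Nonempty V ∧ ∀ u v, G.Joined Set.univ u v

/-! A 1-chain with `ℤ/2` coefficients is identified with the set of edges that occur in it. -/

/-- The vertex set of the subgraph `G : z` induced by a 1-chain `z`. -/
def chainVerts (G : DartGraph V E) (z : Set E) : Set V :=
  {v | ∃ d : Dart E, d.1 ∈ z ∧ G.tail d = v}

/-- `z` induces a circle: `G : z` is nonempty, connected and 2-regular (a loop contributes two
darts, hence degree two, at its vertex). -/
def InducesCircle (G : DartGraph V E) (z : Set E) : Prop :=
  z.Nonempty ∧ (∀ u ∈ G.chainVerts z, ∀ v ∈ G.chainVerts z, G.Joined z u v) ∧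
    ∀ v ∈ G.chainVerts z, {d : Dart E | d.1 ∈ z ∧ G.tail d = v}.ncard = 2

/-- The 1-chain inducing the component of `G : z` that contains the vertex `v`. -/
def componentChain (G : DartGraph V E) (z : Set E) (v : V) : Set E :=
  {e | e ∈ z ∧ G.Joined z v (G.src e)}

/-! ### Voltages -/

/-- The voltage of a dart, when `α e` is the voltage of the positive edge on `e`. -/
def dartVoltage [Group A] (α : E → A) (d : Dart E) : A := if d.2 then α d.1 else (α d.1)⁻¹

/-- The net voltage of a walk. -/
def netVoltage [Group A] (α : E → A) (l : List (Dart E)) : A := (l.map (dartVoltage α)).prod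

theorem IsWalk.append {G : DartGraph V E} {u v w : V} {l l' : List (Dart E)}
    (h : G.IsWalk u l v) (h' : G.IsWalk v l' w) : G.IsWalk u (l ++ l') w := by
  induction l generalizing u with
  | nil => cases h; exact h'
  | cons d l ih => exact ⟨h.1, ih h.2⟩

theorem tail_opp (G : DartGraph V E) (d : Dart E) : G.tail (opp d) = G.head d := by
  rcases d with ⟨e, _ | _⟩ <;> rfl

theorem head_opp (G : DartGraph V E) (d : Dart E) : G.head (opp d) = G.tail d := by
  rcases d with ⟨e, _ | _⟩ <;> rfl

theorem IsWalk.reverse {G : DartGraph V E} {u v : V} {l : List (Dart E)}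
    (h : G.IsWalk u l v) : G.IsWalk v (l.map opp).reverse u := by
  induction l generalizing u with
  | nil => cases h; rfl
  | cons d l ih =>
    rw [List.map_cons, List.reverse_cons]
    exact (ih h.2).append ⟨G.tail_opp d, (G.head_opp d).trans h.1⟩

theorem netVoltage_append [Group A] (α : E → A) (l l' : List (Dart E)) :
    netVoltage α (l ++ l') = netVoltage α l * netVoltage α l' := by
  simp [netVoltage]

theorem dartVoltage_opp [Group A] (α : E → A) (d : Dart E) :
    dartVoltage α (opp d) = (dartVoltage α d)⁻¹ := by
  rcases d with ⟨e, _ | _⟩ <;> simp [dartVoltage, opp]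

theorem netVoltage_reverse [Group A] (α : E → A) (l : List (Dart E)) :
    netVoltage α (l.map opp).reverse = (netVoltage α l)⁻¹ := by
  induction l with
  | nil => simp [netVoltage]
  | cons d l ih =>
    rw [List.map_cons, List.reverse_cons, netVoltage_append, ih]
    simp [netVoltage, dartVoltage_opp]

/-- The local voltage group `A(v)`: net voltages of the closed walks based at `v`. -/
def localGroup [Group A] (G : DartGraph V E) (α : E → A) (v : V) : Subgroup A where
  carrier := {g | ∃ l, G.IsWalk v l v ∧ netVoltage α l = g}
  one_mem' := ⟨[], rfl, rfl⟩
  mul_mem' := by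
    rintro _ _ ⟨l, hl, rfl⟩ ⟨l', hl', rfl⟩
    exact ⟨l ++ l', hl.append hl', netVoltage_append α l l'⟩
  inv_mem' := by
    rintro _ ⟨l, hl, rfl⟩
    exact ⟨_, hl.reverse, netVoltage_reverse α l⟩

/-- The derived graph: `e^a = (e, a)` runs from `(src e)^a` to `(tgt e)^(a * α e)`. -/
def derived [Group A] (G : DartGraph V E) (α : E → A) : DartGraph (V × A) (E × A) where
  src e := (G.src e.1, e.2)
  tgt e := (G.tgt e.1, e.2 * α e.1)

/-- The fiber `z^α` over a 1-chain `z`. -/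
def fiber (A : Type*) (z : Set E) : Set (E × A) := {e | e.1 ∈ z}

/-- A dart of the derived graph is given by the dart below it and the superscript of its tail. -/
def dartLift [Group A] (α : E → A) : Dart (E × A) ≃ Dart E × A where
  toFun d := ((d.1.1, d.2), if d.2 then d.1.2 else d.1.2 * α d.1.1)
  invFun d := ((d.1.1, if d.1.2 then d.2 else d.2 * (α d.1.1)⁻¹), d.1.2)
  left_inv := by rintro ⟨⟨e, a⟩, _ | _⟩ <;> simp
  right_inv := by rintro ⟨⟨e, _ | _⟩, a⟩ <;> simp

theorem tail_derived [Group A] (G : DartGraph V E) (α : E → A) (d : Dart (E × A)) :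
    (G.derived α).tail d = (G.tail (dartLift α d).1, (dartLift α d).2) := by
  rcases d with ⟨⟨e, a⟩, _ | _⟩ <;> simp [tail, dartLift, derived]

end DartGraph

/-! ### Cellular embeddings -/

/-- A cellular embedding of `G` in a closed, possibly nonorientable, surface: a rotation scheme
(`rot` permutes cyclically the darts with any given tail vertex) together with the set of
orientation-reversing edges. -/
structure CellularEmbedding {V E : Type*} (G : DartGraph V E) where
  rot : Equiv.Perm (Dart E)
  rot_cyclic : ∀ d d', G.tail d = G.tail d' ↔ rot.SameCycle d d'
  reversing : Set E

/-- A flag `(d, s)`: the part of the surface next to the tail end of the dart `d`, on the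
counterclockwise side (`s = true`, towards the next dart in the rotation) or on the clockwise side
(`s = false`) of `d`, with respect to the local orientation given by the rotation at the tail. -/
abbrev Flag (E : Type*) := Dart E × Bool

namespace CellularEmbedding

variable {V E A : Type*} {G : DartGraph V E}

open Classical in
/-- The other flag on the same side of the same edge (at the other end of the edge). When the local
orientations at the two ends agree along the edge, the counterclockwise side of `d` at its tail is
the clockwise side of the opposite dart at the tail of the latter. -/
noncomputable def flip₀ (M : CellularEmbedding G) (x : Flag E) : Flag E :=
  (opp x.1, if x.1.1 ∈ M.reversing then x.2 else !x.2)

/-- The other flag in the same corner. -/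
def flip₁ (M : CellularEmbedding G) (x : Flag E) : Flag E :=
  if x.2 then (M.rot x.1, false) else (M.rot.symm x.1, true)

/-- The flag across the edge, at the same edge end. -/
def flip₂ (x : Flag E) : Flag E := (x.1, !x.2)

noncomputable def flip (M : CellularEmbedding G) : Fin 3 → Flag E → Flag E :=
  ![M.flip₀, M.flip₁, flip₂]

/-- The gluing of the surface `S` from one triangle for each flag (the barycentric subdivision of
the 2-complex whose faces are the discs attached along the facial boundary walks). The barycentric
coordinates `p 0`, `p 1`, `p 2` belong to the vertex, the edge midpoint and the face centre of the
flag; the side `p i = 0` is glued to the same side of the triangle of the `i`-th neighbouring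
flag. -/
def GlueRel (M : CellularEmbedding G) (q r : Σ _ : Flag E, stdSimplex ℝ (Fin 3)) : Prop :=
  ∃ i : Fin 3, q.2.1 i = 0 ∧ r.1 = M.flip i q.1 ∧ r.2 = q.2

/-- The underlying surface of the embedding, with the quotient topology. -/
def Surface (M : CellularEmbedding G) : Type _ := Quot M.GlueRel

instance (M : CellularEmbedding G) : TopologicalSpace M.Surface :=
  inferInstanceAs (TopologicalSpace (Quot M.GlueRel))

/-- The point of the surface with barycentric coordinates `p` in the triangle of the flag `x`. -/
def point (M : CellularEmbedding G) (x : Flag E) (p : stdSimplex ℝ (Fin 3)) : M.Surface :=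
  Quot.mk _ ⟨x, p⟩

/-- The image of the vertex `v` in the surface (one point, as soon as some dart starts at `v`). -/
def vertexSet (M : CellularEmbedding G) (v : V) : Set M.Surface :=
  {q | ∃ x p, G.tail x.1 = v ∧ p.1 0 = 1 ∧ q = M.point x p}

/-- The image in the surface of the subgraph `G : z` (its edges together with their ends). -/
def chainSet (M : CellularEmbedding G) (z : Set E) : Set M.Surface :=
  {q | ∃ x p, x.1.1 ∈ z ∧ p.1 2 = 0 ∧ q = M.point x p}

/-- The component `S_v` of the surface that contains the vertex `v`. -/
def componentAt (M : CellularEmbedding G) (v : V) : Set M.Surface :=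
  ⋃ q ∈ M.vertexSet v, connectedComponent q

/-- `G : z` is nonseparating: its complement in the surface is connected. -/
def Nonseparating (M : CellularEmbedding G) (z : Set E) : Prop :=
  IsConnected (M.chainSet z)ᶜ

/-- `z` has an even number of orientation-reversing edges. -/
def OrientationPreserving (M : CellularEmbedding G) (z : Set E) : Prop :=
  Even (z ∩ M.reversing).ncard

/-- `G : z` is a disjoint union of orientation-preserving circles. -/
def IsUnionOfPreservingCircles (M : CellularEmbedding G) (z : Set E) : Prop :=
  ∀ v ∈ G.chainVerts z,
    G.InducesCircle (G.componentChain z v) ∧ M.OrientationPreserving (G.componentChain z v)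

/-- The z-regions of `K` (the surface or a component of it) with respect to a set `T` of 1-chains
inducing circles: `K` is cut along all these circles, and the regions are the closures of the
connected pieces. -/
def zRegions (M : CellularEmbedding G) (K : Set M.Surface) (T : Set (Set E)) :
    Set (Set M.Surface) :=
  {R | ∃ q ∈ K \ ⋃ z ∈ T, M.chainSet z,
    R = closure (connectedComponentIn (K \ ⋃ z ∈ T, M.chainSet z) q)}

/-! ### The derived embedding -/

/-- The lifted rotation: at `v^a` it follows the rotation at `v`. -/
def derivedRot [Group A] (M : CellularEmbedding G) (α : E → A) : Equiv.Perm (Dart (E × A)) :=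
  ((DartGraph.dartLift α).trans (M.rot.prodCongr (Equiv.refl A))).trans
    (DartGraph.dartLift α).symm

theorem dartLift_derivedRot_zpow [Group A] (M : CellularEmbedding G) (α : E → A) (n : ℤ)
    (d : Dart (E × A)) : DartGraph.dartLift α ((M.derivedRot α ^ n) d) =
      ((M.rot ^ n) (DartGraph.dartLift α d).1, (DartGraph.dartLift α d).2) := by
  have h1 : ∀ d, DartGraph.dartLift α (M.derivedRot α d) =
      (M.rot (DartGraph.dartLift α d).1, (DartGraph.dartLift α d).2) := by
    intro d; simp [derivedRot, Prod.map]
  have h2 : ∀ d, DartGraph.dartLift α ((M.derivedRot α)⁻¹ d) =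
      (M.rot⁻¹ (DartGraph.dartLift α d).1, (DartGraph.dartLift α d).2) := by
    intro d
    have h := h1 ((M.derivedRot α)⁻¹ d)
    rw [← Equiv.Perm.mul_apply, mul_inv_cancel, Equiv.Perm.one_apply] at h
    rw [h]; simp
  induction n generalizing d with
  | zero => simp
  | succ n ih => rw [zpow_add_one, zpow_add_one, Equiv.Perm.mul_apply, ih, h1]; rfl
  | pred n ih => rw [zpow_sub_one, zpow_sub_one, Equiv.Perm.mul_apply, ih, h2]; rfl

/-- The derived embedding `G^α → S^α`: rotations and orientation types of edges are lifted, so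
that the facial boundaries are the lifts of the facial boundaries of `G → S`. -/
def derived [Group A] (M : CellularEmbedding G) (α : E → A) :
    CellularEmbedding (G.derived α) where
  rot := M.derivedRot α
  rot_cyclic d d' := by
    rw [G.tail_derived, G.tail_derived, Prod.mk.injEq, M.rot_cyclic]
    constructor
    · rintro ⟨⟨n, hn⟩, h⟩
      refine ⟨n, (DartGraph.dartLift α).injective ?_⟩
      rw [M.dartLift_derivedRot_zpow, hn, h]
    · rintro ⟨n, rfl⟩
      rw [M.dartLift_derivedRot_zpow]
      exact ⟨⟨n, rfl⟩, rfl⟩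
  reversing := DartGraph.fiber A M.reversing

/-! ### The subdivided medial graph -/

/-- The corner containing a flag; `d` stands for the corner between `d` and `rot d`. -/
def corner (M : CellularEmbedding G) (x : Flag E) : Dart E :=
  if x.2 then x.1 else M.rot.symm x.1

/-- The subdivided medial graph `M'`. Its vertices are the vertices `v_e = inl e` of the medial
graph and the midpoints `inr c` of the medial edges drawn across the corners `c`. Its edges are the
halves of the medial edges; they correspond to the flags, the reference direction being towards
`v_e`. -/
def medial (M : CellularEmbedding G) : DartGraph (E ⊕ Dart E) (Flag E) where
  src x := Sum.inr (M.corner x)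
  tgt x := Sum.inl x.1.1

/-- The transferred voltage assignment to `M'`, for a choice of a preferred direction
`(e, pref e)` of every edge `e`. The two edges of `M'` at `v_e` that come from the corners at the
tail of the preferred dart get, directed towards `v_e`, the voltage of that dart. The other two
edges at `v_e` get the voltage `1`. -/
def medialVoltage [Group A] (α : E → A) (pref : E → Bool) (x : Flag E) : A :=
  if x.1.2 = pref x.1.1 then DartGraph.dartVoltage α x.1 else 1

/-- Two consecutive darts of `M'` cross `G : z`: the first one arrives at the vertex `v_e` of an
edge `e` of `z` on one side of `e`, the second one leaves `v_e` on the other side of `e`. -/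
def CrossesAt (M : CellularEmbedding G) (z : Set E) (d d' : Dart (Flag E)) : Prop :=
  d.2 = true ∧ d'.2 = false ∧ d.1.1.1 ∈ z ∧
    (d'.1 = flip₂ d.1 ∨ d'.1 = M.flip₀ (flip₂ d.1))

/-- A walk in `M'` transversely crosses `G : z`. -/
def TransverselyCrosses (M : CellularEmbedding G) (z : Set E) (l : List (Dart (Flag E))) : Prop :=
  ∃ l₁ d d' l₂, l = l₁ ++ d :: d' :: l₂ ∧ M.CrossesAt z d d'

theorem not_transverselyCrosses_iff (M : CellularEmbedding G) (z : Set E)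
    (l : List (Dart (Flag E))) :
    ¬ M.TransverselyCrosses z l ↔ l.IsChain (fun d d' => ¬ M.CrossesAt z d d') := by
  rw [List.isChain_iff_forall_rel_of_append_cons_cons]
  unfold TransverselyCrosses
  constructor
  · intro h a b l₁ l₂ e hc
    exact h ⟨l₁, a, b, l₂, e, hc⟩
  · rintro h ⟨l₁, a, b, l₂, e, hc⟩
    exact h e hc

theorem CrossesAt.reverse {M : CellularEmbedding G} {z : Set E} {d d' : Dart (Flag E)}
    (h : M.CrossesAt z (opp d') (opp d)) : M.CrossesAt z d d' := by
  rcases d with ⟨⟨⟨e, s⟩, t⟩, u⟩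
  rcases d' with ⟨⟨⟨e', s'⟩, t'⟩, u'⟩
  obtain ⟨h1, h2, h3, h4⟩ := h
  simp only [opp, flip₂, flip₀, Prod.mk.injEq] at h1 h2 h3 h4
  rcases h4 with ⟨⟨rfl, rfl⟩, rfl⟩ | ⟨⟨rfl, rfl⟩, rfl⟩
  · simp_all [CrossesAt, opp, flip₂, flip₀]
  · by_cases hr : e ∈ M.reversing <;> simp_all [CrossesAt, opp, flip₂, flip₀]

theorem last_of_isWalk_corner (M : CellularEmbedding G) {u : E ⊕ Dart E} {c : Dart E}
    {l : List (Dart (Flag E))} (h : M.medial.IsWalk u l (Sum.inr c)) :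
    ∀ d ∈ l.getLast?, d.2 = false := by
  induction l generalizing u with
  | nil => simp
  | cons d l ih =>
    cases l with
    | nil =>
      rcases d with ⟨x, _ | _⟩
      · simp
      · have h2 := h.2
        simp [DartGraph.IsWalk, DartGraph.head, medial] at h2
    | cons d' l =>
      rw [List.getLast?_cons_cons]
      exact ih h.2

/-- The group of net voltages of the closed walks in `M'`, based at the vertex of `M'` in the
corner `c`, that do not transversely cross `G : z`. -/
def noncrossingGroup [Group A] (M : CellularEmbedding G) (α : E → A) (pref : E → Bool)
    (z : Set E) (c : Dart E) : Subgroup A where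
  carrier := {g | ∃ l, M.medial.IsWalk (Sum.inr c) l (Sum.inr c) ∧
    ¬ M.TransverselyCrosses z l ∧ DartGraph.netVoltage (medialVoltage α pref) l = g}
  one_mem' := ⟨[], rfl, by simp [TransverselyCrosses], rfl⟩
  mul_mem' := by
    rintro _ _ ⟨l, hl, hn, rfl⟩ ⟨l', hl', hn', rfl⟩
    refine ⟨l ++ l', hl.append hl', ?_, DartGraph.netVoltage_append _ l l'⟩
    rw [not_transverselyCrosses_iff] at hn hn' ⊢
    rw [List.isChain_append]
    refine ⟨hn, hn', fun d hd d' _ hc => ?_⟩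
    have := M.last_of_isWalk_corner hl d hd
    simp [hc.1] at this
  inv_mem' := by
    rintro _ ⟨l, hl, hn, rfl⟩
    refine ⟨_, hl.reverse, ?_, DartGraph.netVoltage_reverse _ l⟩
    rw [not_transverselyCrosses_iff] at hn ⊢
    rw [List.isChain_reverse, List.isChain_map]
    exact hn.imp fun d d' h hc => h hc.reverse

end CellularEmbedding

end VoltageEmbedding

open VoltageEmbedding

/-!
The surface is a union of triangles, one for each flag, and the whole argument is a count of classes
of flags.

In the surface cut along `G : z`, two triangles lie in the same component exactly when they are
joined by a sequence of triangles with common sides off `G : z` (`FlagJoined`): a union of triangles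
that is closed under such adjacency is open off `G : z` (`isOpen_flagUnion_diff`), and a class is
path connected (`connectedComponentIn_flagUnion_diff`). Identified points always have the same
barycentric coordinates (`point_eq_point`), so all topological statements reduce to which
coordinates vanish. The closures of different components differ (`flagRegion_eq_iff`), so the
z-regions of a component of the derived surface correspond to the classes of its flags
(`zRegions_flagUnion`).

A flag of the derived embedding is a pair of a flag of `G` and an element of `A` (`flagLift`), and
two such pairs `(x, b)`, `(y, c)` lie in the same class exactly when a sequence of adjacent flags of
`G` leads from `x` to `y` off `z` with net voltage `b⁻¹ c` (`flagJoined_derived_iff`). Fix a flag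
`x` at `v` in the corner `w`. As `G : z` is nonseparating, every class contains some `(x, b)`, and
`(x, b)` lies in the component of `v^a` exactly when `b ∈ a A(v)`. The closed flag walks at `x` off
`z` have the same net voltages as the noncrossing closed walks at `w` in the subdivided medial graph
(`mem_noncrossingGroup_iff`), since such a walk, passing through `v_e`, either moves along `e`, or
moves across `e` where `e` is not in `z`, or both. Hence the classes in the component correspond to
the left cosets of the noncrossing group in `A(v)`.
-/

namespace VoltageEmbedding

namespace CellularEmbedding

variable {V E A : Type*} {G : DartGraph V E}

/-! ### Flags joined without crossing a chain -/

@[simp] theorem flip_flip (M : CellularEmbedding G) (i : Fin 3) (x : Flag E) :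
    M.flip i (M.flip i x) = x := by
  rcases x with ⟨⟨e, s⟩, t⟩
  fin_cases i
  · by_cases h : e ∈ M.reversing <;> simp [flip, flip₀, opp, h]
  · cases t <;> simp [flip, flip₁]
  · simp [flip, flip₂]

/-- Two flags are adjacent off `z` when their triangles share a side that does not lie on an edge
of `z`. -/
def FlagAdj (M : CellularEmbedding G) (z : Set E) (x y : Flag E) : Prop :=
  ∃ i, y = M.flip i x ∧ (i = 2 → x.1.1 ∉ z)

/-- Two flags are joined off `z` when a sequence of triangles leads from one to the other without
crossing an edge of `z`. -/
def FlagJoined (M : CellularEmbedding G) (z : Set E) : Flag E → Flag E → Prop :=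
  Relation.ReflTransGen (M.FlagAdj z)

theorem FlagAdj.symm {M : CellularEmbedding G} {z : Set E} {x y : Flag E}
    (h : M.FlagAdj z x y) : M.FlagAdj z y x := by
  obtain ⟨i, rfl, hi⟩ := h
  refine ⟨i, (M.flip_flip i x).symm, ?_⟩
  rintro rfl
  exact hi rfl

theorem FlagJoined.symm {M : CellularEmbedding G} {z : Set E} {x y : Flag E}
    (h : M.FlagJoined z x y) : M.FlagJoined z y x :=
  have : Std.Symm (M.FlagAdj z) := ⟨fun _ _ h => h.symm⟩
  symm_of (Relation.ReflTransGen (M.FlagAdj z)) h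

theorem FlagJoined.trans {M : CellularEmbedding G} {z : Set E} {x y w : Flag E}
    (h : M.FlagJoined z x y) (h' : M.FlagJoined z y w) : M.FlagJoined z x w :=
  Relation.ReflTransGen.trans h h'

theorem FlagJoined.mono {M : CellularEmbedding G} {z z' : Set E} (hz : z' ⊆ z) {x y : Flag E}
    (h : M.FlagJoined z x y) : M.FlagJoined z' x y := by
  refine Relation.ReflTransGen.mono ?_ _ _ h
  rintro _ _ ⟨i, hi, hn⟩
  exact ⟨i, hi, fun h2 h3 => hn h2 (hz h3)⟩

theorem flagJoined_flip (M : CellularEmbedding G) {z : Set E} (i : Fin 3) (x : Flag E)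
    (h : i = 2 → x.1.1 ∉ z) : M.FlagJoined z x (M.flip i x) :=
  Relation.ReflTransGen.single ⟨i, rfl, h⟩

/-- All flags at one vertex are joined to each other: the rotation is generated by crossing
corners and edge ends alternately. -/
theorem flagJoined_of_tail_eq (M : CellularEmbedding G) {x y : Flag E}
    (h : G.tail x.1 = G.tail y.1) : M.FlagJoined ∅ x y := by
  have hside : ∀ (d : Dart E) (s t : Bool), M.FlagJoined ∅ (d, s) (d, t) := by
    intro d s t
    by_cases hst : t = s
    · rw [hst]; exact Relation.ReflTransGen.refl
    · obtain rfl : t = !s := by cases s <;> cases t <;> simp_all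
      exact M.flagJoined_flip 2 (d, s) (by simp)
  have hrot : ∀ d : Dart E, M.FlagJoined ∅ (d, true) (M.rot d, true) := fun d =>
    (M.flagJoined_flip 1 (d, true) (by simp)).trans (hside _ _ _)
  obtain ⟨d, s⟩ := x
  obtain ⟨d', t⟩ := y
  obtain ⟨n, hn⟩ := (M.rot_cyclic d d').1 h
  replace hn : (M.rot ^ n) d = d' := hn
  subst hn
  clear h
  refine (hside d s true).trans (FlagJoined.trans ?_ (hside _ true t))
  induction n with
  | zero => exact Relation.ReflTransGen.refl
  | succ n ih =>
    rw [add_comm, zpow_one_add]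
    exact ih.trans (hrot _)
  | pred n ih =>
    rw [sub_eq_add_neg, add_comm, zpow_add, zpow_neg_one]
    refine ih.trans ?_
    have := (hrot (M.rot⁻¹ ((M.rot ^ (-(n : ℤ))) d))).symm
    simpa using this

/-! ### The surface cut along a chain -/

theorem point_flip (M : CellularEmbedding G) {i : Fin 3} (x : Flag E)
    {p : stdSimplex ℝ (Fin 3)} (h : p i = 0) : M.point x p = M.point (M.flip i x) p :=
  Quot.sound ⟨i, h, rfl, rfl⟩

/-- Identified points have the same barycentric coordinates, and their flags are linked through
sides of the triangles that contain the point. -/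
theorem point_eq_point (M : CellularEmbedding G) {x y : Flag E} {p q : stdSimplex ℝ (Fin 3)}
    (h : M.point x p = M.point y q) :
    p = q ∧ Relation.ReflTransGen (fun x y => ∃ i, p i = 0 ∧ y = M.flip i x) x y := by
  have key : ∀ a b : (Σ _ : Flag E, stdSimplex ℝ (Fin 3)), Relation.EqvGen M.GlueRel a b →
      a.2 = b.2 ∧ Relation.ReflTransGen (fun x y => ∃ i, a.2 i = 0 ∧ y = M.flip i x) a.1 b.1 := by
    intro a b hab
    induction hab with
    | rel a b hab =>
      obtain ⟨i, hi, h1, h2⟩ := hab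
      exact ⟨h2.symm, Relation.ReflTransGen.single ⟨i, hi, h1⟩⟩
    | refl a => exact ⟨rfl, Relation.ReflTransGen.refl⟩
    | symm a b _ ih =>
      refine ⟨ih.1.symm, ?_⟩
      rw [← ih.1]
      have : Std.Symm (fun x y => ∃ i, a.2 i = 0 ∧ y = M.flip i x) :=
        ⟨by rintro x y ⟨i, hi, rfl⟩; exact ⟨i, hi, (M.flip_flip i x).symm⟩⟩
      exact symm_of (Relation.ReflTransGen _) ih.2
    | trans a b c _ _ ih ih' =>
      refine ⟨ih.1.trans ih'.1, ih.2.trans ?_⟩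
      rw [ih.1]; exact ih'.2
  exact key ⟨x, p⟩ ⟨y, q⟩ (Quot.eqvGen_exact h)

theorem point_eq_of_reflTransGen (M : CellularEmbedding G) {x y : Flag E}
    {p : stdSimplex ℝ (Fin 3)}
    (h : Relation.ReflTransGen (fun x y => ∃ i, p i = 0 ∧ y = M.flip i x) x y) :
    M.point x p = M.point y p := by
  induction h with
  | refl => rfl
  | tail _ h ih =>
    obtain ⟨i, hi, rfl⟩ := h
    exact ih.trans (M.point_flip _ hi)

theorem isQuotientMap_mk (M : CellularEmbedding G) :
    Topology.IsQuotientMap (fun q : Σ _ : Flag E, stdSimplex ℝ (Fin 3) => M.point q.1 q.2) :=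
  isQuotientMap_quot_mk

theorem continuous_point (M : CellularEmbedding G) (x : Flag E) : Continuous (M.point x) :=
  continuous_quot_mk.comp continuous_sigmaMk

/-- Moving a point off some sides of its triangle, and onto none, does not bring it onto `G : z`. -/
theorem point_notMem_chainSet_of_zeros (M : CellularEmbedding G) {z : Set E} {x : Flag E}
    {p r : stdSimplex ℝ (Fin 3)} (hp : M.point x p ∉ M.chainSet z)
    (hr : ∀ i, r i = 0 → p i = 0) : M.point x r ∉ M.chainSet z := by
  rintro ⟨y, q, hy, hq, h⟩
  obtain ⟨rfl, hc⟩ := M.point_eq_point h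
  refine hp ⟨y, p, hy, hr 2 hq, M.point_eq_of_reflTransGen ?_⟩
  refine Relation.ReflTransGen.mono ?_ _ _ hc
  rintro _ _ ⟨i, hi, e⟩
  exact ⟨i, hr i hi, e⟩

theorem isClosed_chainSet (M : CellularEmbedding G) (z : Set E) : IsClosed (M.chainSet z) := by
  rw [← M.isQuotientMap_mk.isClosed_preimage, isClosed_sigma_iff]
  intro x
  -- In the triangle of `x`, whether a point is identified with a point of `G : z` depends only on
  -- the set of its vanishing coordinates, and persists when that set grows.
  have h : (Sigma.mk x ⁻¹' ((fun q : Σ _ : Flag E, stdSimplex ℝ (Fin 3) => M.point q.1 q.2) ⁻¹'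
      M.chainSet z)) =
      ⋃ I : {I : Set (Fin 3) // 2 ∈ I ∧ ∃ y : Flag E, y.1.1 ∈ z ∧
        Relation.ReflTransGen (fun x y => ∃ i, i ∈ I ∧ y = M.flip i x) x y},
      {p : stdSimplex ℝ (Fin 3) | ∀ i ∈ I.1, p i = 0} := by
    ext p
    simp only [Set.mem_preimage, Set.mem_iUnion, Set.mem_ofPred_eq]
    constructor
    · rintro ⟨y, q, hy, hq, h⟩
      obtain ⟨rfl, hc⟩ := M.point_eq_point (x := x) (p := p) h
      exact ⟨⟨{i | p i = 0}, hq, y, hy, hc⟩, fun i hi => hi⟩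
    · rintro ⟨⟨I, h2, y, hy, hc⟩, hI⟩
      refine ⟨y, p, hy, hI 2 h2, M.point_eq_of_reflTransGen (x := x) (p := p) ?_⟩
      refine Relation.ReflTransGen.mono ?_ _ _ hc
      rintro _ _ ⟨i, hi, e⟩
      exact ⟨i, hI i hi, e⟩
  rw [h]
  refine isClosed_iUnion_of_finite fun I => ?_
  simp only [Set.ofPred_forall]
  refine isClosed_iInter fun i => isClosed_iInter fun _ => ?_
  exact isClosed_eq ((continuous_apply i).comp continuous_subtype_val) continuous_const

/-- The part of the surface covered by the closed triangles of the flags in `U`. -/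
def flagUnion (M : CellularEmbedding G) (U : Set (Flag E)) : Set M.Surface :=
  {q | ∃ x p, x ∈ U ∧ q = M.point x p}

/-- Off `G : z`, identified points have flags joined off `z`; so a saturated set of flags can be
recovered from the points it covers. -/
theorem mem_of_point_mem_flagUnion (M : CellularEmbedding G) {z : Set E} {U : Set (Flag E)}
    (hU : ∀ x ∈ U, ∀ y, M.FlagAdj z x y → y ∈ U) {x : Flag E} {p : stdSimplex ℝ (Fin 3)}
    (h : M.point x p ∈ M.flagUnion U) (hz : M.point x p ∉ M.chainSet z) : x ∈ U := by
  obtain ⟨y, q, hy, h⟩ := h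
  rw [h] at hz
  obtain ⟨rfl, hc⟩ := M.point_eq_point h.symm
  clear h
  induction hc using Relation.ReflTransGen.head_induction_on with
  | refl => exact hy
  | @head a c hac _ ih =>
    obtain ⟨i, hi, rfl⟩ := hac
    refine ih ?_ (hU a hy _ ⟨i, rfl, ?_⟩)
    · rwa [← M.point_flip a hi]
    · rintro rfl ha
      exact hz ⟨a, q, ha, hi, rfl⟩

/-- Off `G : z`, a union of triangles saturated under adjacency off `z` is open: its preimage
consists of whole triangles, cut by the open complement of `G : z`. -/
theorem isOpen_flagUnion_diff (M : CellularEmbedding G) {z : Set E} {U : Set (Flag E)}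
    (hU : ∀ x ∈ U, ∀ y, M.FlagAdj z x y → y ∈ U) : IsOpen (M.flagUnion U \ M.chainSet z) := by
  rw [← M.isQuotientMap_mk.isOpen_preimage, isOpen_sigma_iff]
  intro x
  by_cases hx : x ∈ U
  · convert (M.isClosed_chainSet z).isOpen_compl.preimage (M.continuous_point x) using 1
    ext p
    exact ⟨fun h => h.2, fun h => ⟨⟨x, p, hx, rfl⟩, h⟩⟩
  · convert isOpen_empty using 1
    ext p
    simp only [Set.mem_preimage, Set.mem_empty_iff_false, iff_false]
    exact fun h => hx (M.mem_of_point_mem_flagUnion hU h.1 h.2)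

/-- The barycentre of the triangle. -/
noncomputable def barycentre : stdSimplex ℝ (Fin 3) :=
  ⟨fun _ => 1 / 3, fun _ => by norm_num, by simp⟩

theorem barycentre_ne_zero (i : Fin 3) : barycentre i ≠ 0 := by
  change (1 / 3 : ℝ) ≠ 0
  norm_num

theorem barycentre_notMem_chainSet (M : CellularEmbedding G) (z : Set E) (x : Flag E) :
    M.point x barycentre ∉ M.chainSet z := by
  rintro ⟨y, q, _, hq, h⟩
  obtain ⟨rfl, _⟩ := M.point_eq_point h
  exact barycentre_ne_zero 2 hq

/-- The midpoint of the side `p i = 0` of the triangle. -/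
noncomputable def sideMidpoint (i : Fin 3) : stdSimplex ℝ (Fin 3) :=
  ⟨fun j => if j = i then 0 else 1 / 2, fun j => by dsimp only; split_ifs <;> norm_num, by
    fin_cases i <;> simp [Fin.sum_univ_three] <;> norm_num⟩

theorem sideMidpoint_eq_zero_iff (i j : Fin 3) : sideMidpoint i j = 0 ↔ j = i := by
  change (if j = i then (0 : ℝ) else 1 / 2) = 0 ↔ _
  split_ifs with h <;> simp [h]

theorem sideMidpoint_notMem_chainSet (M : CellularEmbedding G) {z : Set E} {i : Fin 3}
    {x : Flag E} (hx : i = 2 → x.1.1 ∉ z) : M.point x (sideMidpoint i) ∉ M.chainSet z := by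
  rintro ⟨y, q, hy, hq, h⟩
  obtain ⟨rfl, hc⟩ := M.point_eq_point h
  obtain rfl := (sideMidpoint_eq_zero_iff i 2).1 hq
  clear h hq
  have : y.1.1 = x.1.1 := by
    clear hy
    induction hc with
    | refl => rfl
    | tail _ h ih =>
      obtain ⟨j, hj, rfl⟩ := h
      obtain rfl := (sideMidpoint_eq_zero_iff 2 j).1 hj
      exact ih
  exact hx rfl (this ▸ hy)

/-- Within a triangle, every point off `G : z` is joined to the barycentre off `G : z`, along a
segment. -/
theorem joinedIn_barycentre (M : CellularEmbedding G) {z : Set E} {U : Set (Flag E)} {x : Flag E}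
    (hx : x ∈ U) {p : stdSimplex ℝ (Fin 3)} (hp : M.point x p ∉ M.chainSet z) :
    JoinedIn (M.flagUnion U \ M.chainSet z) (M.point x p) (M.point x barycentre) := by
  let f : unitInterval → stdSimplex ℝ (Fin 3) := fun t =>
    ⟨(1 - (t : ℝ)) • (p : Fin 3 → ℝ) + (t : ℝ) • (barycentre : Fin 3 → ℝ),
      convex_stdSimplex ℝ (Fin 3) p.2 barycentre.2 (by linarith [t.2.2]) t.2.1 (by ring)⟩
  have hf : Continuous f := by
    refine Continuous.subtype_mk ?_ _
    fun_prop
  refine ⟨⟨⟨fun t => M.point x (f t), (M.continuous_point x).comp hf⟩, ?_, ?_⟩, fun t => ?_⟩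
  · change M.point x (f 0) = _
    congr 1
    apply Subtype.ext
    simp [f]
    rfl
  · change M.point x (f 1) = _
    congr 1
    apply Subtype.ext
    simp [f]
    rfl
  · refine ⟨⟨x, f t, hx, rfl⟩, M.point_notMem_chainSet_of_zeros hp fun i hi => ?_⟩
    have h1 : (1 - (t : ℝ)) * p i + (t : ℝ) * (1 / 3) = 0 := hi
    have h2 : 0 ≤ (1 - (t : ℝ)) * p i := mul_nonneg (by linarith [t.2.2]) (p.2.1 i)
    have h3 : (t : ℝ) = 0 := by linarith [t.2.1]
    rw [h3] at h1
    linarith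

theorem joinedIn_of_flagJoined (M : CellularEmbedding G) {z : Set E} {U : Set (Flag E)}
    (hU : ∀ x ∈ U, ∀ y, M.FlagAdj z x y → y ∈ U) {x y : Flag E} (hx : x ∈ U)
    (h : M.FlagJoined z x y) :
    y ∈ U ∧
    JoinedIn (M.flagUnion U \ M.chainSet z) (M.point x barycentre) (M.point y barycentre) := by
  induction h with
  | refl => exact ⟨hx, JoinedIn.refl ⟨⟨x, _, hx, rfl⟩, M.barycentre_notMem_chainSet z x⟩⟩
  | @tail y w _ h ih =>
    obtain ⟨hy, hj⟩ := ih
    have hw := hU y hy w h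
    refine ⟨hw, hj.trans ?_⟩
    obtain ⟨i, rfl, hi⟩ := h
    have h1 := M.sideMidpoint_notMem_chainSet hi
    have h2 := M.point_flip y ((sideMidpoint_eq_zero_iff i i).2 rfl)
    refine (M.joinedIn_barycentre hy h1).symm.trans ?_
    rw [h2] at h1 ⊢
    exact M.joinedIn_barycentre hw h1

/-- The components of the surface cut along `G : z` are the unions of the classes of flags joined
off `z`. -/
theorem connectedComponentIn_flagUnion_diff (M : CellularEmbedding G) {z : Set E}
    {U : Set (Flag E)} (hU : ∀ x ∈ U, ∀ y, M.FlagAdj z x y → y ∈ U) {x : Flag E} (hx : x ∈ U)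
    {p : stdSimplex ℝ (Fin 3)} (hp : M.point x p ∉ M.chainSet z) :
    connectedComponentIn (M.flagUnion U \ M.chainSet z) (M.point x p) =
      M.flagUnion {y | M.FlagJoined z x y} \ M.chainSet z := by
  have hC : ∀ a ∈ {y | M.FlagJoined z x y}, ∀ b, M.FlagAdj z a b →
      b ∈ {y | M.FlagJoined z x y} := fun a ha b hab => Relation.ReflTransGen.tail ha hab
  have hD : ∀ a ∈ {y | M.FlagJoined z x y}ᶜ, ∀ b, M.FlagAdj z a b →
      b ∈ {y | M.FlagJoined z x y}ᶜ :=
    fun a ha b hab hb => ha (Relation.ReflTransGen.tail hb hab.symm)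
  have hxF : M.point x p ∈ M.flagUnion U \ M.chainSet z := ⟨⟨x, p, hx, rfl⟩, hp⟩
  apply Set.Subset.antisymm
  · refine isPreconnected_connectedComponentIn.subset_left_of_subset_union
      (M.isOpen_flagUnion_diff hC) (M.isOpen_flagUnion_diff hD) ?_ ?_
      ⟨_, mem_connectedComponentIn hxF, ⟨x, p, Relation.ReflTransGen.refl, rfl⟩, hp⟩
    · rw [Set.disjoint_left]
      rintro _ ⟨⟨y, q, hy, rfl⟩, hq⟩ ⟨h', -⟩
      exact M.mem_of_point_mem_flagUnion hD h' hq hy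
    · rintro r hr
      obtain ⟨⟨y, q, _, rfl⟩, hz⟩ := connectedComponentIn_subset _ _ hr
      by_cases hy : M.FlagJoined z x y
      · exact Or.inl ⟨⟨y, q, hy, rfl⟩, hz⟩
      · exact Or.inr ⟨⟨y, q, hy, rfl⟩, hz⟩
  · rintro _ ⟨⟨y, q, hy, rfl⟩, hq⟩
    obtain ⟨hyU, hj⟩ := M.joinedIn_of_flagJoined hU hx hy
    have hj' := ((M.joinedIn_barycentre hx hp).trans hj).trans (M.joinedIn_barycentre hyU hq).symm
    obtain ⟨γ, hγ⟩ := hj'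
    refine (isPreconnected_range γ.continuous).subset_connectedComponentIn
      ⟨0, γ.source⟩ ?_ ⟨1, γ.target⟩
    rintro _ ⟨t, rfl⟩
    exact hγ t

theorem chainSet_empty (M : CellularEmbedding G) : M.chainSet ∅ = ∅ := by
  ext q
  simp [chainSet]

theorem flagUnion_univ (M : CellularEmbedding G) : M.flagUnion Set.univ = Set.univ := by
  refine Set.eq_univ_of_forall fun q => ?_
  induction q using Quot.inductionOn with
  | h a => exact ⟨a.1, a.2, trivial, rfl⟩

/-- The component of the surface containing a vertex is the union of the triangles joined to a
flag at that vertex. -/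
theorem componentAt_eq_flagUnion (M : CellularEmbedding G) (x : Flag E) :
    M.componentAt (G.tail x.1) = M.flagUnion {y | M.FlagJoined ∅ x y} := by
  have key : ∀ (y : Flag E) p,
      connectedComponent (M.point y p) = M.flagUnion {w | M.FlagJoined ∅ y w} := by
    intro y p
    have := M.connectedComponentIn_flagUnion_diff (z := ∅) (U := Set.univ) (x := y) (p := p)
      (fun _ _ _ _ => trivial) trivial (by simp [chainSet_empty])
    simpa [chainSet_empty, flagUnion_univ, connectedComponentIn_univ] using this
  have hclass : ∀ y : Flag E, G.tail y.1 = G.tail x.1 →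
      {w | M.FlagJoined ∅ y w} = {w | M.FlagJoined ∅ x w} := fun y hy => Set.ext fun w =>
    ⟨(M.flagJoined_of_tail_eq hy.symm).trans, (M.flagJoined_of_tail_eq hy).trans⟩
  apply Set.Subset.antisymm
  · refine Set.iUnion₂_subset ?_
    rintro _ ⟨y, p, hy, _, rfl⟩
    rw [key, hclass y hy]
  · have h0 : (Pi.single 0 1 : Fin 3 → ℝ) ∈ stdSimplex ℝ (Fin 3) := single_mem_stdSimplex ℝ 0
    rw [← key x ⟨_, h0⟩]
    exact Set.subset_biUnion_of_mem (u := fun q => connectedComponent q)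
      (show M.point x ⟨_, h0⟩ ∈ M.vertexSet (G.tail x.1) from ⟨x, _, rfl, by simp, rfl⟩)

/-- If `G : z` is nonseparating, any two flags are joined off `z`. -/
theorem Nonseparating.flagJoined {M : CellularEmbedding G} {z : Set E} (h : M.Nonseparating z)
    (x y : Flag E) : M.FlagJoined z x y := by
  have hc := M.connectedComponentIn_flagUnion_diff (z := z) (U := Set.univ)
    (fun _ _ _ _ => trivial) (Set.mem_univ x) (M.barycentre_notMem_chainSet z x)
  rw [flagUnion_univ, ← Set.compl_eq_univ_sdiff,
    h.isPreconnected.connectedComponentIn (M.barycentre_notMem_chainSet z x)] at hc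
  have hy : M.point y barycentre ∈ (M.chainSet z)ᶜ := M.barycentre_notMem_chainSet z y
  rw [hc] at hy
  exact M.mem_of_point_mem_flagUnion (U := {y | M.FlagJoined z x y})
    (fun a ha b hab => Relation.ReflTransGen.tail ha hab) hy.1 hy.2

/-- The closure of the region of the cut surface that contains the flag `x`. -/
def flagRegion (M : CellularEmbedding G) (z : Set E) (x : Flag E) : Set M.Surface :=
  closure (M.flagUnion {y | M.FlagJoined z x y} \ M.chainSet z)

/-- Distinct regions have distinct closures: each is open and contains a barycentre. -/
theorem flagRegion_eq_iff (M : CellularEmbedding G) {z : Set E} {x y : Flag E} :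
    M.flagRegion z x = M.flagRegion z y ↔ M.FlagJoined z x y := by
  have hC : ∀ x, ∀ a ∈ {y | M.FlagJoined z x y}, ∀ b, M.FlagAdj z a b →
      b ∈ {y | M.FlagJoined z x y} := fun x a ha b hab => Relation.ReflTransGen.tail ha hab
  constructor
  · intro h
    have hx : M.point x barycentre ∈ M.flagUnion {y | M.FlagJoined z x y} \ M.chainSet z :=
      ⟨⟨x, _, Relation.ReflTransGen.refl, rfl⟩, M.barycentre_notMem_chainSet z x⟩
    have hx' : M.point x barycentre ∈ M.flagRegion z y := h ▸ subset_closure hx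
    obtain ⟨_, ⟨⟨w, p, hw, rfl⟩, hp⟩, h2, -⟩ :=
      mem_closure_iff.1 hx' _ (M.isOpen_flagUnion_diff (hC x)) hx
    exact hw.trans (M.mem_of_point_mem_flagUnion (hC y) h2 hp).symm
  · intro h
    have : {w | M.FlagJoined z x w} = {w | M.FlagJoined z y w} :=
      Set.ext fun w => ⟨h.symm.trans, h.trans⟩
    rw [flagRegion, flagRegion, this]

/-- The regions of a union `K` of components, when the cutting chains together contain exactly those
edges of `z` that lie in `K`. -/
theorem zRegions_flagUnion (M : CellularEmbedding G) {z : Set E} {T : Set (Set E)}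
    {U : Set (Flag E)} (hU : ∀ x ∈ U, ∀ y, M.FlagAdj ∅ x y → y ∈ U) (hT : ∀ C ∈ T, C ⊆ z)
    (hz : ∀ x ∈ U, x.1.1 ∈ z → ∃ C ∈ T, x.1.1 ∈ C) :
    M.zRegions (M.flagUnion U) T = M.flagRegion z '' U := by
  have hU' : ∀ x ∈ U, ∀ y, M.FlagAdj z x y → y ∈ U :=
    fun x hx y ⟨i, hi, _⟩ => hU x hx y ⟨i, hi, fun _ => by simp⟩
  have hdiff : M.flagUnion U \ ⋃ C ∈ T, M.chainSet C = M.flagUnion U \ M.chainSet z := by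
    ext q
    refine and_congr_right fun hq => not_congr ?_
    simp only [Set.mem_iUnion]
    constructor
    · rintro ⟨C, hC, x, p, hx, hp, rfl⟩
      exact ⟨x, p, hT C hC hx, hp, rfl⟩
    · rintro ⟨x, p, hx, hp, rfl⟩
      have hxU := M.mem_of_point_mem_flagUnion hU hq (by simp [chainSet_empty])
      obtain ⟨C, hC, hxC⟩ := hz x hxU hx
      exact ⟨C, hC, x, p, hxC, hp, rfl⟩
  unfold zRegions
  rw [hdiff]
  ext R
  constructor
  · rintro ⟨_, ⟨⟨x, p, hx, rfl⟩, hp⟩, rfl⟩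
    exact ⟨x, hx, by rw [M.connectedComponentIn_flagUnion_diff hU' hx hp]; rfl⟩
  · rintro ⟨x, hx, rfl⟩
    have hb := M.barycentre_notMem_chainSet z x
    exact ⟨_, ⟨⟨x, _, hx, rfl⟩, hb⟩,
      by rw [M.connectedComponentIn_flagUnion_diff hU' hx hb]; rfl⟩

end CellularEmbedding

/-! ### Lifting walks -/

namespace DartGraph

variable {V E A : Type*}

/-- A walk of `G` lifts to the derived graph, from any superscript of its first vertex. -/
theorem IsWalk.joined_derived [Group A] {G : DartGraph V E} (α : E → A) {z : Set E} {u v : V}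
    {l : List (Dart E)} (h : G.IsWalk u l v) (hz : ∀ d ∈ l, d.1 ∈ z) (c : A) :
    (G.derived α).Joined (fiber A z) (u, c) (v, c * netVoltage α l) := by
  induction l generalizing u c with
  | nil =>
    cases h
    exact ⟨[], by simp [IsWalk, netVoltage], by simp⟩
  | cons d l ih =>
    obtain ⟨rfl, h⟩ := h
    obtain ⟨l', hl', hz'⟩ := ih h (fun d hd => hz d (by simp [hd])) (c * dartVoltage α d)
    refine ⟨(dartLift α).symm (d, c) :: l', ⟨?_, ?_⟩, ?_⟩
    · rw [tail_derived, Equiv.apply_symm_apply]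
    · convert hl' using 1
      · rcases d with ⟨e, _ | _⟩ <;> simp [head, dartLift, derived, dartVoltage]
      · simp [netVoltage, mul_assoc]
    · intro d' hd'
      rcases List.mem_cons.1 hd' with rfl | hd'
      · exact hz d (by simp)
      · exact hz' d' hd'

theorem Joined.symm {G : DartGraph V E} {z : Set E} {u v : V} (h : G.Joined z u v) :
    G.Joined z v u := by
  obtain ⟨l, hl, hz⟩ := h
  refine ⟨_, hl.reverse, fun d hd => ?_⟩
  obtain ⟨d', hd', rfl⟩ := List.mem_map.1 (List.mem_reverse.1 hd)
  exact hz d' hd'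

end DartGraph

namespace CellularEmbedding

open DartGraph

variable {V E A : Type*} {G : DartGraph V E}

/-! ### Voltages of flag walks -/

/-- The voltage picked up when passing from a flag to its `i`-th neighbour: only moving along the
edge, to its other end, changes the superscript of the vertex of the flag. -/
def flipVoltage [Group A] (α : E → A) (i : Fin 3) (x : Flag E) : A :=
  if i = 0 then dartVoltage α x.1 else 1

/-- `M.FlagWalk α z x y g`: some sequence of adjacent triangles leads from the flag `x` to the flag
`y` without crossing an edge of `z`, and has net voltage `g`. -/
inductive FlagWalk [Group A] (M : CellularEmbedding G) (α : E → A) (z : Set E) (x : Flag E) :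
    Flag E → A → Prop
  | refl : FlagWalk M α z x x 1
  | step {y : Flag E} {g : A} (i : Fin 3) (h : FlagWalk M α z x y g) (hi : i = 2 → y.1.1 ∉ z) :
      FlagWalk M α z x (M.flip i y) (g * flipVoltage α i y)

/-- A flag of the derived embedding is given by the flag below it and the superscript of its
vertex. -/
def flagLift [Group A] (α : E → A) : Flag (E × A) ≃ Flag E × A where
  toFun y := (((dartLift α y.1).1, y.2), (dartLift α y.1).2)
  invFun q := ((dartLift α).symm (q.1.1, q.2), q.1.2)
  left_inv y := by simp
  right_inv q := by simp

theorem flagLift_flip [Group A] (M : CellularEmbedding G) (α : E → A) (i : Fin 3)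
    (y : Flag (E × A)) : flagLift α ((M.derived α).flip i y) =
      (M.flip i (flagLift α y).1, (flagLift α y).2 * flipVoltage α i (flagLift α y).1) := by
  rcases y with ⟨⟨⟨e, a⟩, s⟩, t⟩
  fin_cases i
  · cases s <;>
      simp [flip, flip₀, flagLift, dartLift, flipVoltage, opp, dartVoltage, derived, fiber]
  · cases t <;> simp [flip, flip₁, flagLift, flipVoltage, derived, derivedRot]
  · simp [flip, flip₂, flagLift, flipVoltage]

theorem tail_flagLift_symm [Group A] (G : DartGraph V E) (α : E → A) (x : Flag E) (b : A) :
    (G.derived α).tail ((flagLift α).symm (x, b)).1 = (G.tail x.1, b) := by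
  rw [tail_derived]
  simp [flagLift]

theorem FlagJoined.flagWalk [Group A] {M : CellularEmbedding G} {α : E → A} {z : Set E}
    {X Y : Flag (E × A)} (h : (M.derived α).FlagJoined (fiber A z) X Y) :
    M.FlagWalk α z (flagLift α X).1 (flagLift α Y).1
      ((flagLift α X).2⁻¹ * (flagLift α Y).2) := by
  induction h with
  | refl => rw [inv_mul_cancel]; exact FlagWalk.refl
  | tail _ h ih =>
    obtain ⟨i, rfl, hi⟩ := h
    rw [flagLift_flip, ← mul_assoc]
    exact FlagWalk.step i ih hi

theorem FlagWalk.flagJoined [Group A] {M : CellularEmbedding G} {α : E → A} {z : Set E}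
    {x y : Flag E} {g : A} (h : M.FlagWalk α z x y g) (b : A) :
    (M.derived α).FlagJoined (fiber A z) ((flagLift α).symm (x, b))
      ((flagLift α).symm (y, b * g)) := by
  induction h with
  | refl => rw [mul_one]; exact Relation.ReflTransGen.refl
  | @step y g i _ hi ih =>
    refine Relation.ReflTransGen.tail ih ⟨i, (flagLift α).injective ?_, hi⟩
    simp [flagLift_flip, mul_assoc]

/-- Whether two flags lie in one region of the cut derived surface is decided by walks in the base
embedding. -/
theorem flagJoined_derived_iff [Group A] (M : CellularEmbedding G) (α : E → A) (z : Set E)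
    (x y : Flag E) (b c : A) :
    (M.derived α).FlagJoined (fiber A z) ((flagLift α).symm (x, b)) ((flagLift α).symm (y, c)) ↔
      M.FlagWalk α z x y (b⁻¹ * c) := by
  constructor
  · intro h
    simpa using h.flagWalk
  · intro h
    simpa using h.flagJoined b

theorem FlagJoined.exists_flagWalk [Group A] {M : CellularEmbedding G} (α : E → A) {z : Set E}
    {x y : Flag E} (h : M.FlagJoined z x y) : ∃ g, M.FlagWalk α z x y g := by
  induction h with
  | refl => exact ⟨1, FlagWalk.refl⟩
  | tail _ h ih =>
    obtain ⟨i, rfl, hi⟩ := h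
    obtain ⟨g, hg⟩ := ih
    exact ⟨_, FlagWalk.step i hg hi⟩

theorem FlagWalk.trans [Group A] {M : CellularEmbedding G} {α : E → A} {z : Set E}
    {x y w : Flag E} {g h : A} (h₁ : M.FlagWalk α z x y g) (h₂ : M.FlagWalk α z y w h) :
    M.FlagWalk α z x w (g * h) := by
  induction h₂ with
  | refl => rwa [mul_one]
  | step i _ hi ih => rw [← mul_assoc]; exact FlagWalk.step i ih hi

/-- Moving along a flag walk, the vertices of the flags trace a walk of `G` with the same
voltage. -/
theorem FlagWalk.exists_isWalk [Group A] {M : CellularEmbedding G} {α : E → A} {z : Set E}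
    {x y : Flag E} {g : A} (h : M.FlagWalk α z x y g) :
    ∃ l, G.IsWalk (G.tail x.1) l (G.tail y.1) ∧ netVoltage α l = g := by
  induction h with
  | refl => exact ⟨[], rfl, rfl⟩
  | @step y g i _ hi ih =>
    obtain ⟨l, hl, rfl⟩ := ih
    fin_cases i
    · refine ⟨l ++ [y.1], hl.append ⟨rfl, (G.tail_opp y.1).symm⟩, ?_⟩
      simp [netVoltage, flipVoltage]
    · refine ⟨l, ?_, by simp [flipVoltage]⟩
      convert hl using 1
      rcases y with ⟨d, _ | _⟩
      · exact (M.rot_cyclic _ _).2 ⟨1, by simp [flip, flip₁]⟩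
      · exact (M.rot_cyclic _ _).2 ⟨-1, by simp [flip, flip₁]⟩
    · exact ⟨l, hl, by simp [flipVoltage]⟩

/-- Conversely a walk of `G` is followed by a flag walk, which may cross all edges in order to turn
around the vertices. -/
theorem flagWalk_of_isWalk [Group A] (M : CellularEmbedding G) (α : E → A) {x y : Flag E}
    {l : List (Dart E)} (h : G.IsWalk (G.tail x.1) l (G.tail y.1)) :
    M.FlagWalk α ∅ x y (netVoltage α l) := by
  have hvert : ∀ x y : Flag E, G.tail x.1 = G.tail y.1 → M.FlagWalk α ∅ x y 1 := by
    intro x y h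
    have := (M.derived α).flagJoined_of_tail_eq (x := (flagLift α).symm (x, 1))
      (y := (flagLift α).symm (y, 1)) (by rw [tail_flagLift_symm, tail_flagLift_symm, h])
    simpa using (M.flagJoined_derived_iff α ∅ x y 1 1).1 this
  induction l generalizing x with
  | nil => exact hvert x y h
  | cons d l ih =>
    obtain ⟨h1, h2⟩ := h
    have h3 : M.FlagWalk α ∅ x (M.flip 0 (d, true)) (1 * flipVoltage α 0 (d, true)) :=
      FlagWalk.step 0 (hvert x (d, true) h1.symm) (by simp)
    have h4 := h3.trans (ih (x := M.flip 0 (d, true)) (by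
      change G.IsWalk (G.tail (opp d)) l _
      rwa [tail_opp]))
    simpa [netVoltage, flipVoltage] using h4

/-! ### Flag walks and walks in the subdivided medial graph -/

theorem corner_flip_one (M : CellularEmbedding G) (x : Flag E) :
    M.corner (M.flip 1 x) = M.corner x := by
  rcases x with ⟨d, _ | _⟩ <;> simp [corner, flip, flip₁]

theorem eq_or_eq_flip_one_of_corner_eq (M : CellularEmbedding G) {x y : Flag E}
    (h : M.corner x = M.corner y) : y = x ∨ y = M.flip 1 x := by
  rcases x with ⟨d, _ | _⟩ <;> rcases y with ⟨d', _ | _⟩ <;>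
    simp_all [corner, flip, flip₁]

/-- Passing through `v_e`, a walk in `M'` picks up the same voltage as the corresponding sequence of
flag moves: the transferred voltages give `α` when the walk turns along `e`, and cancel when it
turns around an end of `e`. -/
theorem medialVoltage_flip [Group A] (M : CellularEmbedding G) (α : E → A) (pref : E → Bool)
    {i : Fin 3} (hi : i ≠ 1) (x : Flag E) :
    medialVoltage α pref x * (medialVoltage α pref (M.flip i x))⁻¹ = flipVoltage α i x := by
  rcases x with ⟨⟨e, s⟩, t⟩
  fin_cases i
  · by_cases h : s = pref e
    · have : (!s) ≠ pref e := by simp [← h]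
      simp [medialVoltage, flip, flip₀, opp, flipVoltage, h]
    · have : (!s) = pref e := by cases s <;> cases h' : pref e <;> simp_all
      have h2 : (dartVoltage α (e, !s))⁻¹ = dartVoltage α (e, s) := by
        rw [← dartVoltage_opp]; simp [opp]
      rw [this] at h2
      simp [medialVoltage, flip, flip₀, opp, flipVoltage, h, this, h2]
  · exact absurd rfl hi
  · simp [medialVoltage, flip, flip₂, flipVoltage]

theorem not_crossesAt_flip (M : CellularEmbedding G) {z : Set E} {i : Fin 3} (hi : i ≠ 1)
    {x : Flag E} (h : i = 2 → x.1.1 ∉ z) :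
    ¬ M.CrossesAt z (x, true) (M.flip i x, false) := by
  rcases x with ⟨⟨e, s⟩, t⟩
  rintro ⟨-, -, hz, hc⟩
  fin_cases i
  · by_cases hr : e ∈ M.reversing <;> simp [flip, flip₀, flip₂, opp, hr] at hc
  · exact hi rfl
  · exact h rfl hz

/-- A pair of consecutive medial darts through `v_e` that does not cross `G : z` is followed by
flag moves off `z`. -/
theorem flagWalk_of_not_crossesAt [Group A] (M : CellularEmbedding G) (α : E → A) (pref : E → Bool)
    {z : Set E} {x y : Flag E} (he : y.1.1 = x.1.1)
    (hc : ¬ M.CrossesAt z (x, true) (y, false)) :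
    M.FlagWalk α z x y (medialVoltage α pref x * (medialVoltage α pref y)⁻¹) := by
  -- There are four flags on an edge.
  have hy : y = x ∨ y = M.flip 0 x ∨ y = M.flip 2 x ∨ y = M.flip 0 (M.flip 2 x) := by
    rcases x with ⟨⟨e, s⟩, t⟩
    rcases y with ⟨⟨e', s'⟩, t'⟩
    obtain rfl : e' = e := he
    by_cases hr : e' ∈ M.reversing <;> cases s <;> cases s' <;> cases t <;> cases t' <;>
      simp [flip, flip₀, flip₂, opp, hr]
  rcases hy with rfl | rfl | rfl | rfl
  · rw [mul_inv_cancel]; exact FlagWalk.refl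
  · rw [M.medialVoltage_flip α pref (by decide), ← one_mul (flipVoltage α 0 x)]
    exact FlagWalk.step 0 FlagWalk.refl (by simp)
  · have hz : x.1.1 ∉ z := fun hz => hc ⟨rfl, rfl, hz, Or.inl rfl⟩
    rw [M.medialVoltage_flip α pref (by decide), ← one_mul (flipVoltage α 2 x)]
    exact FlagWalk.step 2 FlagWalk.refl fun _ => hz
  · have hz : x.1.1 ∉ z := fun hz => hc ⟨rfl, rfl, hz, Or.inr rfl⟩
    have h1 := FlagWalk.step 0 (FlagWalk.step 2 (FlagWalk.refl (M := M) (α := α) (z := z) (x := x))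
      fun _ => hz) (by simp)
    rw [← M.medialVoltage_flip α pref (i := 2) (by decide),
      ← M.medialVoltage_flip α pref (i := 0) (by decide)] at h1
    simpa [mul_assoc] using h1

theorem flagWalk_of_corner_eq [Group A] (M : CellularEmbedding G) (α : E → A) (z : Set E)
    {x y : Flag E} (h : M.corner x = M.corner y) : M.FlagWalk α z x y 1 := by
  rcases M.eq_or_eq_flip_one_of_corner_eq h with rfl | rfl
  · exact FlagWalk.refl
  · have := FlagWalk.step (M := M) (α := α) (z := z) (x := x) 1 FlagWalk.refl (by simp)
    simpa [flipVoltage] using this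

/-- A walk in `M'` between corners that does not cross `G : z` is followed by a flag walk off `z`
with the same voltage. -/
theorem flagWalk_of_medial_isWalk [Group A] (M : CellularEmbedding G) (α : E → A)
    (pref : E → Bool) {z : Set E} {y : Flag E} :
    ∀ (l : List (Dart (Flag E))) (x : Flag E),
      M.medial.IsWalk (Sum.inr (M.corner x)) l (Sum.inr (M.corner y)) →
      l.IsChain (fun d d' => ¬ M.CrossesAt z d d') →
      M.FlagWalk α z x y (netVoltage (medialVoltage α pref) l)
  | [], x, h, _ => M.flagWalk_of_corner_eq α z (Sum.inr_injective h)
  | [d], x, h, _ => by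
    rcases d with ⟨x', _ | _⟩
    · simp [IsWalk, tail, medial] at h
    · simp [IsWalk, head, medial] at h
  | d :: d' :: l, x, h, hn => by
    obtain ⟨h1, h2, h3⟩ := h
    rcases d with ⟨x', _ | _⟩
    · simp [tail, medial] at h1
    rcases d' with ⟨y', _ | _⟩
    swap
    · simp [tail, head, medial] at h2
    simp only [tail, head, medial, if_true, Bool.false_eq_true, if_false, Sum.inr.injEq,
      Sum.inl.injEq] at h1 h2
    rw [List.isChain_cons_cons] at hn
    have w1 := M.flagWalk_of_corner_eq α z h1.symm
    have w2 := M.flagWalk_of_not_crossesAt α pref h2 hn.1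
    have w3 := flagWalk_of_medial_isWalk M α pref l y' h3 hn.2.tail
    have := w1.trans (w2.trans w3)
    simpa [netVoltage, dartVoltage, mul_assoc] using this

/-- A flag walk off `z` is followed by a walk in `M'` that does not cross `G : z` and has the same
voltage: moves across corners stay at one vertex of `M'`, and the other moves pass through a
vertex `v_e`. -/
theorem FlagWalk.exists_medial_isWalk [Group A] {M : CellularEmbedding G} {α : E → A}
    (pref : E → Bool) {z : Set E} {x y : Flag E} {g : A} (h : M.FlagWalk α z x y g) :
    ∃ l, M.medial.IsWalk (Sum.inr (M.corner x)) l (Sum.inr (M.corner y)) ∧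
      ¬ M.TransverselyCrosses z l ∧ netVoltage (medialVoltage α pref) l = g := by
  simp only [not_transverselyCrosses_iff]
  induction h with
  | refl => exact ⟨[], rfl, List.isChain_nil, rfl⟩
  | @step y g i _ hi ih =>
    obtain ⟨l, hl, hn, rfl⟩ := ih
    by_cases h1 : i = 1
    · subst h1
      exact ⟨l, by rwa [corner_flip_one], hn, by simp [flipVoltage]⟩
    · refine ⟨l ++ [(y, true), (M.flip i y, false)], hl.append ⟨rfl, ?_, rfl⟩, ?_, ?_⟩
      · have : (M.flip i y).1.1 = y.1.1 := by fin_cases i <;> first | rfl | exact absurd rfl h1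
        simp [tail, head, medial, this]
      · rw [List.isChain_append]
        refine ⟨hn, by simpa using M.not_crossesAt_flip h1 hi, fun d hd d' _ hc => ?_⟩
        have := M.last_of_isWalk_corner hl d hd
        simp [hc.1] at this
      · rw [netVoltage_append, ← M.medialVoltage_flip α pref h1]
        simp [netVoltage, dartVoltage]

theorem mem_noncrossingGroup_iff [Group A] (M : CellularEmbedding G) (α : E → A) (pref : E → Bool)
    (z : Set E) (x : Flag E) (g : A) :
    g ∈ M.noncrossingGroup α pref z (M.corner x) ↔ M.FlagWalk α z x x g := by
  constructor
  · rintro ⟨l, hl, hn, rfl⟩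
    exact M.flagWalk_of_medial_isWalk α pref l x hl ((M.not_transverselyCrosses_iff z l).1 hn)
  · exact fun h => h.exists_medial_isWalk pref

end CellularEmbedding

/-! ### Counting -/

/-- The values of a map on a group that identifies exactly the elements of the same left coset of a
subgroup are as many as the cosets. -/
theorem ncard_range_mul_card {L X : Type*} [Group L] (H : Subgroup L) (f : L → X)
    (hf : ∀ g g', f g = f g' ↔ g⁻¹ * g' ∈ H) :
    (Set.range f).ncard * Nat.card H = Nat.card L := by
  rw [H.card_eq_card_quotient_mul_card_subgroup, ← Nat.card_coe_set_eq]
  congr 1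
  have : QuotientGroup.leftRel H = Setoid.ker f := by
    ext g g'
    rw [QuotientGroup.leftRel_apply, Setoid.ker_def, hf]
  unfold HasQuotient.Quotient QuotientGroup.instHasQuotientSubgroup
  dsimp only
  rw [this]
  exact (Nat.card_congr (Setoid.quotientKerEquivRange f)).symm

end VoltageEmbedding

theorem theorem3p17 {V E A : Type*} [Finite V] [Finite E] [Group A] [Finite A]
    (G : DartGraph V E) (hG : G.IsConnectedGraph)
    (M : CellularEmbedding G) (α : E → A) (pref : E → Bool)
    (z : Set E) (hz : G.InducesCircle z) (hsep : M.Nonseparating z)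
    (hfib : (M.derived α).IsUnionOfPreservingCircles (DartGraph.fiber A z))
    (v : V) (d : Dart E) (hd : d.1 ∈ z) (hv : G.tail d = v)
    (w : Dart E) (hw : w = M.corner (d, true) ∨ w = M.corner (d, false)) (a : A) :
    (((M.derived α).zRegions ((M.derived α).componentAt (v, a))
        {C | ∃ b : A, a⁻¹ * b ∈ G.localGroup α v ∧
          C = (G.derived α).componentChain (DartGraph.fiber A z) (v, b)}).ncard : ℚ) =
      (Nat.card (G.localGroup α v) : ℚ) / Nat.card (M.noncrossingGroup α pref z w) := by
  obtain ⟨x, hx, rfl⟩ : ∃ x : Flag E, x.1 = d ∧ w = M.corner x := by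
    rcases hw with hw | hw
    exacts [⟨(d, true), rfl, hw⟩, ⟨(d, false), rfl, hw⟩]
  have hxv : G.tail x.1 = v := by rw [hx, hv]
  -- `X b` is the flag over `x` at the vertex `v^b`.
  let X : A → Flag (E × A) := fun b => (CellularEmbedding.flagLift α).symm (x, b)
  have hX : (G.derived α).tail (X a).1 = (v, a) := by
    rw [← hxv]; exact CellularEmbedding.tail_flagLift_symm G α x a
  let U : Set (Flag (E × A)) := {Y | (M.derived α).FlagJoined ∅ (X a) Y}
  have hU : ∀ Y ∈ U, ∀ Y', (M.derived α).FlagAdj ∅ Y Y' → Y' ∈ U :=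
    fun Y hY Y' h => Relation.ReflTransGen.tail hY h
  -- `X b` lies in the component of `v^a` exactly when `b ∈ aA(v)`.
  have hXU : ∀ b, X b ∈ U ↔ a⁻¹ * b ∈ G.localGroup α v := by
    intro b
    refine (M.flagJoined_derived_iff α ∅ x x a b).trans ⟨fun h => ?_, ?_⟩
    · rw [← hxv]; exact h.exists_isWalk
    · rintro ⟨l, hl, hg⟩
      rw [← hxv] at hl
      rw [← hg]
      exact M.flagWalk_of_isWalk α hl
  have hK : (M.derived α).componentAt (v, a) = (M.derived α).flagUnion U := by
    rw [← hX]; exact (M.derived α).componentAt_eq_flagUnion (X a)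
  -- A flag of this component on an edge over `z` lies on the circle through one of these `v^b`.
  have hT : ∀ Y ∈ U, Y.1.1 ∈ DartGraph.fiber A z → ∃ C ∈ {C | ∃ b : A,
      a⁻¹ * b ∈ G.localGroup α v ∧
        C = (G.derived α).componentChain (DartGraph.fiber A z) (v, b)}, Y.1.1 ∈ C := by
    rintro ⟨⟨⟨e, c⟩, s⟩, t⟩ hY (he : e ∈ z)
    obtain ⟨t', hY'⟩ : ∃ t', (((e, c), true), t') ∈ U := by
      cases s
      · exact ⟨_, hU _ hY _ ⟨0, rfl, by simp⟩⟩
      · exact ⟨t, hY⟩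
    obtain ⟨l, hl, hlc⟩ := ((CellularEmbedding.FlagJoined.flagWalk (z := ∅) hY')).exists_isWalk
    rw [show CellularEmbedding.flagLift α (X a) = (x, a) from Equiv.apply_symm_apply _ _] at hl hlc
    obtain ⟨l', hl', hz'⟩ := hz.2.1 (G.src e) ⟨(e, true), he, rfl⟩ v ⟨d, hd, hv⟩
    refine ⟨_, ⟨c * DartGraph.netVoltage α l', ?_, rfl⟩, he,
      (hl'.joined_derived α hz' c).symm⟩
    refine ⟨l ++ l', DartGraph.IsWalk.append (v := G.src e) ?_ hl', ?_⟩
    · rw [← hxv]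
      exact hl
    · rw [DartGraph.netVoltage_append, hlc]
      simp [CellularEmbedding.flagLift, DartGraph.dartLift, mul_assoc]
  have hregions : (M.derived α).zRegions ((M.derived α).componentAt (v, a))
        {C | ∃ b : A, a⁻¹ * b ∈ G.localGroup α v ∧
          C = (G.derived α).componentChain (DartGraph.fiber A z) (v, b)} =
      Set.range fun g : G.localGroup α v =>
        (M.derived α).flagRegion (DartGraph.fiber A z) (X (a * g)) := by
    rw [hK, (M.derived α).zRegions_flagUnion hU (z := DartGraph.fiber A z) ?_ hT]
    · ext R
      constructor
      · rintro ⟨Y, hY, rfl⟩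
        -- Since `G : z` is nonseparating, every region contains a flag over `x`.
        obtain ⟨g, hg⟩ := (hsep.flagJoined (CellularEmbedding.flagLift α Y).1 x).exists_flagWalk α
        have hj := hg.flagJoined (CellularEmbedding.flagLift α Y).2
        rw [Prod.mk.eta, Equiv.symm_apply_apply] at hj
        set b := (CellularEmbedding.flagLift α Y).2 * g
        have hb : X b ∈ U :=
          CellularEmbedding.FlagJoined.trans hY (hj.mono (Set.empty_subset _))
        refine ⟨⟨a⁻¹ * b, (hXU b).1 hb⟩, ?_⟩
        simp only [mul_inv_cancel_left]
        exact ((M.derived α).flagRegion_eq_iff.2 hj).symm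
      · rintro ⟨g, rfl⟩
        exact ⟨_, (hXU _).2 (by simp), rfl⟩
    · rintro _ ⟨b, -, rfl⟩ e he
      exact he.1
  have hmem := M.mem_noncrossingGroup_iff α pref z x
  have hle : M.noncrossingGroup α pref z (M.corner x) ≤ G.localGroup α v := by
    intro g hg
    rw [← hxv]
    exact ((hmem g).1 hg).exists_isWalk
  have hcount := ncard_range_mul_card
    ((M.noncrossingGroup α pref z (M.corner x)).subgroupOf (G.localGroup α v))
    (fun g : G.localGroup α v =>
      (M.derived α).flagRegion (DartGraph.fiber A z) (X (a * g))) (fun g g' => by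
        rw [(M.derived α).flagRegion_eq_iff, M.flagJoined_derived_iff, Subgroup.mem_subgroupOf,
          hmem]
        simp [mul_assoc])
  rw [Nat.card_congr (Subgroup.subgroupOfEquivOfLe hle).toEquiv] at hcount
  rw [hregions, eq_div_iff (Nat.cast_ne_zero.2 Nat.card_pos.ne')]
  exact_mod_cast hcount
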